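/- Let $H$ be an infinite-dimensional complex Hilbert space (not necessarily separable), and let $\mathcal G_{\aleph_0}(H)$ be the set of all closed subspaces $X\subset H$ that are separable, infinite-dimensional and of infinite codimension in $H$. Let $h:\mathcal G_{\aleph_0}(H)\to\mathcal G_{\aleph_0}(H)$ be a bijection preserving inclusion in both directions, i.e. $$X\subseteq Y\iff h(X)\subseteq h(Y)\qquad\text{for all } X,Y\in\mathcal G_{\aleph_0}(H).$$ Then there is an invertible (i.e. bijective) linear or conjugate-linear operator $A:H\to H$, not assumed to be bounded, such that $h(X)=A(X)$ for every $X\in\mathcal G_{\aleph_0}(H)$, and the restriction of $A$ to every $X\in\mathcal G_{\aleph_0}(H)$ is bounded. -/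

import Mathlib

/-- The Grassmannian of all closed separable infinite-dimensional subspaces of infinite codimension
in a complex Hilbert space `H`, ordered by inclusion. -/
abbrev GrassmannianAlephZero (H : Type*) [NormedAddCommGroup H] [InnerProductSpace ℂ H] : Type _ :=
  {X : Submodule ℂ H // IsClosed (X : Set H) ∧ TopologicalSpace.IsSeparable (X : Set H) ∧
    ¬ FiniteDimensional ℂ X ∧ ¬ FiniteDimensional ℂ (H ⧸ X)}

/-- The transformation `h` of the Grassmannian is induced by the map `A` on `H`:
`h X` is the image of `X` under `A`, for every element `X` of the Grassmannian. -/
def IsInducedBy {H : Type*} [NormedAddCommGroup H] [InnerProductSpace ℂ H]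
    (h : GrassmannianAlephZero H → GrassmannianAlephZero H) (A : H → H) : Prop :=
  ∀ X : GrassmannianAlephZero H, ((h X).1 : Set H) = A '' (X.1 : Set H)

/-- The restriction of `A` to every element of the Grassmannian is bounded (with a bound that may
depend on the element), in the sense of bounded (conjugate-)linear operators. -/
def BoundedOnElements {H : Type*} [NormedAddCommGroup H] [InnerProductSpace ℂ H]
    (A : H → H) : Prop :=
  ∀ X : GrassmannianAlephZero H, ∃ C : ℝ, ∀ x ∈ X.1, ‖A x‖ ≤ C * ‖x‖

/-!
The theorem is a form of the fundamental theorem of projective geometry, followed by the argument of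
Mackey and Kakutani that forces the field endomorphism to be continuous. Points of `H` are not
elements of the Grassmannian, so they have to be recovered from its order first.

*Points inside one element.* The elements covered by `Z` are the closed hyperplanes of `Z`, that is,
the `Z ⊓ vᗮ` with nonzero `v ∈ Z` (`hyp`), so an order automorphism `k` maps hyperplanes of `Z` to
hyperplanes of `k Z`. For a point `p` of `k Z`, the normals `v` of the hyperplanes of `Z` whose image
contains `p` form a subspace of codimension one (`normalsThrough`). Its intersection with `Yᗮ`, for
`Y ≤ Z` in the Grassmannian, is the orthogonal complement in `Z` of the element corresponding to
`k Y + ℂ p`, hence is closed; splitting `Z` into two orthogonal elements shows that the whole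
subspace is closed. A vector normal to it is the point of `Z` corresponding to `p`
(`exists_point_of_le`).

*Points of `H`.* Any two elements through a common point are joined by a chain of comparable elements
through that point (`exists_link`), so the point found does not depend on `Z` (`exists_point`).
As spans of two vectors are intersections of elements of the Grassmannian, the point
correspondence respects collinearity and is given by a `σ`-semilinear map `A` for some endomorphism
`σ` of `ℂ` (`PreservesCollinearity.exists_semilinear`).

*Continuity.* Since `A` maps closed hyperplanes of `X` to closed hyperplanes of `h X`, bounded
functionals `⟪n, ·⟫` on `X` and `⟪y, ·⟫` on `h X` correspond: `⟪y, A x⟫ = σ ⟪n, x⟫ * c`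
(`exists_inner_map_eq`). If `σ` were discontinuous, an `n` with tiny coordinates along an orthonormal
sequence `u` and with huge `σ`-images of these coordinates would contradict the boundedness of
`⟪y, ·⟫` (`continuous_of_mem_iff`). So `σ` is the identity or the conjugation, and the same formula
shows that the restriction of `A` to `X` has closed graph (`boundedOnElements_of_mem_iff`).
-/

/-! ### Infinite-dimensional subspaces and membership in the Grassmannian -/

open scoped InnerProductSpace

section Basics

variable {H : Type*} [NormedAddCommGroup H] [InnerProductSpace ℂ H]

theorem not_finiteDimensional_of_le {V W : Submodule ℂ H} (hVW : V ≤ W)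
    (hV : ¬ FiniteDimensional ℂ V) : ¬ FiniteDimensional ℂ W := fun _ =>
  hV (Submodule.finiteDimensional_of_le hVW)

theorem not_finiteDimensional_inf_orthogonal {V F : Submodule ℂ H} [FiniteDimensional ℂ F]
    (hV : ¬ FiniteDimensional ℂ V) : ¬ FiniteDimensional ℂ (V ⊓ Fᗮ : Submodule ℂ H) := by
  intro hfin
  apply hV
  let P : V →ₗ[ℂ] F := (F.orthogonalProjectionOnto : H →ₗ[ℂ] F) ∘ₗ V.subtype
  have hker : FiniteDimensional ℂ (LinearMap.ker P) := by
    have hmem (x : LinearMap.ker P) : (x.1 : H) ∈ V ⊓ Fᗮ := by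
      refine ⟨x.1.2, ?_⟩
      have := x.2
      rw [LinearMap.mem_ker] at this
      exact Submodule.orthogonalProjectionOnto_eq_zero_iff.1 this
    let j : LinearMap.ker P →ₗ[ℂ] (V ⊓ Fᗮ : Submodule ℂ H) :=
      (V.subtype ∘ₗ (LinearMap.ker P).subtype).codRestrict _ hmem
    refine FiniteDimensional.of_injective j fun x y hxy => ?_
    have := congrArg (fun z : (V ⊓ Fᗮ : Submodule ℂ H) => (z : H)) hxy
    exact Subtype.ext (Subtype.ext this)
  have hquot : FiniteDimensional ℂ (V ⧸ LinearMap.ker P) :=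
    P.quotKerEquivRange.symm.finiteDimensional
  exact Module.Finite.of_submodule_quotient (LinearMap.ker P)

theorem exists_norm_eq_one_mem_orthogonal {V F : Submodule ℂ H} [FiniteDimensional ℂ F]
    (hV : ¬ FiniteDimensional ℂ V) : ∃ x ∈ V ⊓ Fᗮ, ‖x‖ = 1 := by
  have h1 : V ⊓ Fᗮ ≠ ⊥ := by
    intro h
    apply not_finiteDimensional_inf_orthogonal (F := F) hV
    rw [h]
    infer_instance
  obtain ⟨x, hx, hx0⟩ := Submodule.exists_mem_ne_zero_of_ne_bot h1
  exact ⟨((‖x‖⁻¹ : ℝ) : ℂ) • x, Submodule.smul_mem _ _ hx, by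
    simp [norm_smul, hx0]⟩

theorem not_finiteDimensional_of_orthonormal {u : ℕ → H} (hu : Orthonormal ℂ u)
    {V : Submodule ℂ H} (hV : ∀ n, u n ∈ V) : ¬ FiniteDimensional ℂ V := by
  intro h
  have hli : LinearIndependent ℂ (fun n => (⟨u n, hV n⟩ : V)) :=
    LinearIndependent.of_comp V.subtype hu.linearIndependent
  exact not_finite_iff_infinite.2 (inferInstance : Infinite ℕ) hli.finite

/-- Three infinite-dimensional subspaces contain orthonormal sequences whose members are all
mutually orthogonal, and orthogonal to a prescribed finite-dimensional subspace. -/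
theorem exists_three_orthonormal {V₁ V₂ V₃ : Submodule ℂ H} (F : Submodule ℂ H)
    [FiniteDimensional ℂ F]
    (h₁ : ¬ FiniteDimensional ℂ V₁) (h₂ : ¬ FiniteDimensional ℂ V₂)
    (h₃ : ¬ FiniteDimensional ℂ V₃) :
    ∃ x y z : ℕ → H, Orthonormal ℂ x ∧ Orthonormal ℂ y ∧ Orthonormal ℂ z ∧
      (∀ n, x n ∈ V₁ ⊓ Fᗮ) ∧ (∀ n, y n ∈ V₂ ⊓ Fᗮ) ∧ (∀ n, z n ∈ V₃ ⊓ Fᗮ) ∧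
      (∀ m n, ⟪x m, y n⟫_ℂ = 0) ∧ (∀ m n, ⟪x m, z n⟫_ℂ = 0) ∧ (∀ m n, ⟪y m, z n⟫_ℂ = 0) := by
  obtain ⟨f, hf, hr⟩ := exists_seq_of_forall_finset_exists (α := H × H × H)
    (fun t => (t.1 ∈ V₁ ⊓ Fᗮ ∧ ‖t.1‖ = 1) ∧ (t.2.1 ∈ V₂ ⊓ Fᗮ ∧ ‖t.2.1‖ = 1) ∧
      (t.2.2 ∈ V₃ ⊓ Fᗮ ∧ ‖t.2.2‖ = 1) ∧
      ⟪t.1, t.2.1⟫_ℂ = 0 ∧ ⟪t.1, t.2.2⟫_ℂ = 0 ∧ ⟪t.2.1, t.2.2⟫_ℂ = 0)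
    (fun s t => ∀ a ∈ ({s.1, s.2.1, s.2.2} : Set H), ∀ b ∈ ({t.1, t.2.1, t.2.2} : Set H),
      ⟪a, b⟫_ℂ = 0) (by
    intro s _
    let T : Set H := ⋃ t ∈ s, ({t.1, t.2.1, t.2.2} : Set H)
    have hT : T.Finite := s.finite_toSet.biUnion fun t _ => by simp
    let F₀ := F ⊔ Submodule.span ℂ T
    have : FiniteDimensional ℂ (Submodule.span ℂ T) := FiniteDimensional.span_of_finite ℂ hT
    obtain ⟨a, ⟨haV, haF⟩, ha⟩ := exists_norm_eq_one_mem_orthogonal (F := F₀) h₁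
    obtain ⟨b, ⟨hbV, hbF⟩, hb⟩ :=
      exists_norm_eq_one_mem_orthogonal (F := F₀ ⊔ Submodule.span ℂ {a}) h₂
    obtain ⟨c, ⟨hcV, hcF⟩, hc⟩ :=
      exists_norm_eq_one_mem_orthogonal (F := F₀ ⊔ Submodule.span ℂ {a} ⊔ Submodule.span ℂ {b}) h₃
    simp only [← Submodule.inf_orthogonal, F₀] at haF hbF hcF
    refine ⟨(a, b, c), ⟨⟨⟨haV, haF.1⟩, ha⟩, ⟨⟨hbV, hbF.1.1⟩, hb⟩, ⟨⟨hcV, hcF.1.1.1⟩, hc⟩,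
      Submodule.mem_orthogonal_singleton_iff_inner_right.1 hbF.2,
      Submodule.mem_orthogonal_singleton_iff_inner_right.1 hcF.1.2,
      Submodule.mem_orthogonal_singleton_iff_inner_right.1 hcF.2⟩, ?_⟩
    intro t ht d hd e he
    have hdT : d ∈ Submodule.span ℂ T :=
      Submodule.subset_span (Set.mem_biUnion (Finset.mem_coe.2 ht) hd)
    rcases he with rfl | rfl | rfl
    · exact (Submodule.mem_orthogonal _ _).1 haF.2 d hdT
    · exact (Submodule.mem_orthogonal _ _).1 hbF.1.2 d hdT
    · exact (Submodule.mem_orthogonal _ _).1 hcF.1.1.2 d hdT)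
  have key : ∀ {m n}, m ≠ n → ∀ a ∈ ({(f m).1, (f m).2.1, (f m).2.2} : Set H),
      ∀ b ∈ ({(f n).1, (f n).2.1, (f n).2.2} : Set H), ⟪a, b⟫_ℂ = 0 := by
    intro m n hmn a ha b hb
    rcases lt_or_gt_of_ne hmn with h | h
    · exact hr m n h a ha b hb
    · rw [← inner_conj_symm, hr n m h b hb a ha, map_zero]
  refine ⟨fun n => (f n).1, fun n => (f n).2.1, fun n => (f n).2.2,
    ⟨fun n => (hf n).1.2, fun m n h => key h _ (by simp) _ (by simp)⟩,
    ⟨fun n => (hf n).2.1.2, fun m n h => key h _ (by simp) _ (by simp)⟩,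
    ⟨fun n => (hf n).2.2.1.2, fun m n h => key h _ (by simp) _ (by simp)⟩,
    fun n => (hf n).1.1, fun n => (hf n).2.1.1, fun n => (hf n).2.2.1.1, ?_, ?_, ?_⟩
  all_goals
    intro m n
    rcases eq_or_ne m n with rfl | h
    · first
      | exact (hf m).2.2.2.1
      | exact (hf m).2.2.2.2.1
      | exact (hf m).2.2.2.2.2
    · exact key h _ (by simp) _ (by simp)

variable [CompleteSpace H]

theorem not_finiteDimensional_quotient_iff {K : Submodule ℂ H} (hK : IsClosed (K : Set H)) :
    ¬ FiniteDimensional ℂ (H ⧸ K) ↔ ¬ FiniteDimensional ℂ Kᗮ := by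
  have : CompleteSpace K := hK.completeSpace_coe
  let e := Submodule.quotientEquivOfIsCompl K Kᗮ (Submodule.isCompl_orthogonal K)
  exact not_congr ⟨fun h => e.finiteDimensional, fun h => e.symm.finiteDimensional⟩

/-- A vector of `Z` orthogonal to the complement of a closed subspace `B` inside `Z` lies in `B`. -/
theorem mem_of_orthogonal_relative_complement {B Z : Submodule ℂ H} (hB : IsClosed (B : Set H))
    (hBZ : B ≤ Z) {q : H} (hq : q ∈ Z) (h : ∀ v ∈ Z, v ∈ Bᗮ → ⟪v, q⟫_ℂ = 0) : q ∈ B := by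
  have : CompleteSpace B := hB.completeSpace_coe
  have h1 : q - B.starProjection q ∈ Bᗮ := B.sub_starProjection_mem_orthogonal q
  have h2 : B.starProjection q ∈ B := Submodule.starProjection_apply_mem _ _
  have h3 := h _ (Z.sub_mem hq (hBZ h2)) h1
  have h4 : ⟪q - B.starProjection q, B.starProjection q⟫_ℂ = 0 :=
    Submodule.inner_left_of_mem_orthogonal h2 h1
  have h5 : ⟪q - B.starProjection q, q - B.starProjection q⟫_ℂ = 0 := by
    rw [inner_sub_right, h3, h4, sub_zero]
  rw [inner_self_eq_zero, sub_eq_zero] at h5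
  rw [h5]; exact h2

end Basics

/-- The property defining the elements of the Grassmannian, as a predicate on subspaces. -/
abbrev IsGr {H : Type*} [NormedAddCommGroup H] [InnerProductSpace ℂ H] (X : Submodule ℂ H) : Prop :=
  IsClosed (X : Set H) ∧ TopologicalSpace.IsSeparable (X : Set H) ∧
    ¬ FiniteDimensional ℂ X ∧ ¬ FiniteDimensional ℂ (H ⧸ X)

section Gr

variable {H : Type*} [NormedAddCommGroup H] [InnerProductSpace ℂ H] [CompleteSpace H]

theorem IsGr.orthogonal {X : Submodule ℂ H} (hX : IsGr X) : ¬ FiniteDimensional ℂ Xᗮ :=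
  (not_finiteDimensional_quotient_iff hX.1).1 hX.2.2.2

theorem IsGr.of_le {X Y : Submodule ℂ H} (hX : IsGr X) (hYX : Y ≤ X) (hY : IsClosed (Y : Set H))
    (hY' : ¬ FiniteDimensional ℂ Y) : IsGr Y :=
  ⟨hY, hX.2.1.mono hYX, hY', (not_finiteDimensional_quotient_iff hY).2
    (not_finiteDimensional_of_le (Submodule.orthogonal_le hYX) hX.orthogonal)⟩

theorem IsGr.sup {X F : Submodule ℂ H} [FiniteDimensional ℂ F] (hX : IsGr X) : IsGr (X ⊔ F) := by
  have hc : IsClosed ((X ⊔ F : Submodule ℂ H) : Set H) :=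
    X.isClosed_sup_finiteDimensional F hX.1
  refine ⟨hc, ?_, not_finiteDimensional_of_le le_sup_left hX.2.2.1, ?_⟩
  · have hF : TopologicalSpace.IsSeparable (F : Set H) := by
      have : ProperSpace F := FiniteDimensional.proper ℂ F
      have : TopologicalSpace.SeparableSpace F := inferInstance
      exact TopologicalSpace.IsSeparable.of_subtype _
    have := (hX.2.1.union hF).span (R := ℂ)
    rwa [Submodule.span_union, Submodule.span_eq, Submodule.span_eq] at this
  · rw [not_finiteDimensional_quotient_iff hc, ← Submodule.inf_orthogonal]
    exact not_finiteDimensional_inf_orthogonal hX.orthogonal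

/-- The closed span of a countable set is an element of the Grassmannian if the set contains an
orthonormal sequence and another orthonormal sequence is orthogonal to it. -/
theorem isGr_of_orthonormal {S : Set H} (hS : S.Countable) {u v : ℕ → H}
    (hu : Orthonormal ℂ u) (hv : Orthonormal ℂ v) (huS : ∀ n, u n ∈ S)
    (hvS : ∀ n, ∀ s ∈ S, ⟪s, v n⟫_ℂ = 0) :
    IsGr (Submodule.span ℂ S).topologicalClosure := by
  have hc := (Submodule.span ℂ S).isClosed_topologicalClosure
  refine ⟨hc, ?_, ?_, ?_⟩
  · rw [Submodule.topologicalClosure_coe]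
    exact (hS.isSeparable.span (R := ℂ)).closure
  · exact not_finiteDimensional_of_orthonormal hu fun n =>
      Submodule.le_topologicalClosure _ (Submodule.subset_span (huS n))
  · rw [not_finiteDimensional_quotient_iff hc, Submodule.orthogonal_closure]
    refine not_finiteDimensional_of_orthonormal hv fun n => ?_
    rw [Submodule.mem_orthogonal]
    intro s hs
    have hle : Submodule.span ℂ S ≤ (Submodule.span ℂ {v n})ᗮ :=
      Submodule.span_le.2 fun s hs => by
        rw [SetLike.mem_coe, Submodule.mem_orthogonal_singleton_iff_inner_left]
        exact hvS n s hs
    have := hle hs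
    rwa [Submodule.mem_orthogonal_singleton_iff_inner_left] at this

theorem IsGr.inf_orthogonal {X F : Submodule ℂ H} [FiniteDimensional ℂ F] (hX : IsGr X) :
    IsGr (X ⊓ Fᗮ) :=
  hX.of_le inf_le_left (hX.1.inter F.isClosed_orthogonal)
    (not_finiteDimensional_inf_orthogonal hX.2.2.1)

end Gr

/-! ### The fundamental theorem of projective geometry -/

section Projective

open Submodule

variable {K L V W : Type*} [Field K] [Field L] [AddCommGroup V] [Module K V] [AddCommGroup W]
  [Module L W]

theorem exists_smul_eq_of_mem_span_singleton {L W : Type*} [Field L] [AddCommGroup W] [Module L W]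
    {v w : W} (hw : w ∈ span L {v}) (hw0 : w ≠ 0) : ∃ c : L, c ≠ 0 ∧ v = c • w := by
  obtain ⟨c, rfl⟩ := mem_span_singleton.1 hw
  have hc : c ≠ 0 := by rintro rfl; simp at hw0
  exact ⟨c⁻¹, inv_ne_zero hc, by rw [smul_smul, inv_mul_cancel₀ hc, one_smul]⟩

/-- A choice of representatives for a map between projective spaces that preserves and reflects
collinearity; the zero vector is carried along to keep case distinctions out of the statements. -/
structure PreservesCollinearity (K L : Type*) {V W : Type*} [Field K] [Field L] [AddCommGroup V]
    [Module K V] [AddCommGroup W] [Module L W] (f : V → W) : Prop where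
  eq_zero_iff : ∀ x, f x = 0 ↔ x = 0
  mem_span_pair_iff : ∀ x y z, f x ∈ span L {f y, f z} ↔ x ∈ span K {y, z}

namespace PreservesCollinearity

variable {f : V → W}

theorem mem_span_singleton_iff (hf : PreservesCollinearity K L f) (x y : V) :
    f x ∈ span L {f y} ↔ x ∈ span K {y} := by
  simpa using hf.mem_span_pair_iff x y y

/-- Nonzero vectors on the image lines of linearly independent vectors `e`, `x`, `y` are linearly
independent. -/
theorem linearIndependent_triple (hf : PreservesCollinearity K L f) {e x y : V} {w₁ w₂ : W}
    (he : e ≠ 0) (hx : x ∉ span K {e})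
    (hy : y ∉ span K {e, x}) (h₁ : w₁ ∈ span L {f x}) (h₂ : w₂ ∈ span L {f y}) (h₁0 : w₁ ≠ 0)
    (h₂0 : w₂ ≠ 0) {a b c : L} (h : a • f e + b • w₁ + c • w₂ = 0) : a = 0 ∧ b = 0 ∧ c = 0 := by
  obtain ⟨s, hs, hs'⟩ := exists_smul_eq_of_mem_span_singleton h₁ h₁0
  obtain ⟨t, ht, ht'⟩ := exists_smul_eq_of_mem_span_singleton h₂ h₂0
  have hc : c = 0 := by
    by_contra hc
    apply hy
    rw [← hf.mem_span_pair_iff, mem_span_pair]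
    refine ⟨-(t * c⁻¹ * a), -(t * c⁻¹ * b * s⁻¹), ?_⟩
    have : w₂ = -(c⁻¹ • (a • f e + b • w₁)) := by
      rw [eq_neg_iff_add_eq_zero, ← smul_right_injective W hc |>.eq_iff]
      simp only [smul_add, smul_smul, mul_inv_cancel₀ hc, ← mul_assoc, smul_zero, one_mul]
      rw [← h]; abel
    rw [ht', this, hs']
    match_scalars <;> field_simp
  subst hc
  have hb : b = 0 := by
    by_contra hb
    apply hx
    rw [← hf.mem_span_singleton_iff, mem_span_singleton]
    refine ⟨-(s * b⁻¹ * a), ?_⟩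
    have : w₁ = -(b⁻¹ • (a • f e)) := by
      rw [eq_neg_iff_add_eq_zero, ← smul_right_injective W hb |>.eq_iff]
      simp only [smul_add, smul_smul, mul_inv_cancel₀ hb, ← mul_assoc, smul_zero, one_mul]
      rw [← h]; simp [add_comm]
    rw [hs', this]
    simp only [smul_neg, smul_smul, neg_smul, mul_assoc]
  subst hb
  have he' : f e ≠ 0 := mt (hf.eq_zero_iff e).1 he
  simpa [he'] using h

/-- The normalisation of `f` relative to `e`: the line through `f x` contains a unique vector `w`
with `f e + w` on the line through `f (e + x)`. -/
theorem existsUnique_normalised (hf : PreservesCollinearity K L f) {e x : V} (he : e ≠ 0)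
    (hx : x = 0 ∨ x ∉ span K {e}) :
    ∃! w : W, w ∈ span L {f x} ∧ f e + w ∈ span L {f (e + x)} := by
  rcases hx with rfl | hx
  · have h0 : f 0 = 0 := (hf.eq_zero_iff 0).2 rfl
    refine ⟨0, by simp [mem_span_singleton_self], fun w hw => by simpa [h0] using hw.1⟩
  · have hx0 : x ≠ 0 := by rintro rfl; exact hx (zero_mem _)
    have h1 : f (e + x) ∈ span L {f e, f x} :=
      (hf.mem_span_pair_iff _ _ _).2 (add_mem (subset_span (by simp)) (subset_span (by simp)))
    obtain ⟨a, b, hab⟩ := mem_span_pair.1 h1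
    have ha : a ≠ 0 := by
      rintro rfl
      have : f (e + x) ∈ span L {f x} := mem_span_singleton.2 ⟨b, by simpa using hab⟩
      rw [hf.mem_span_singleton_iff, mem_span_singleton] at this
      obtain ⟨c, hc⟩ := this
      have hc' : (c - 1) • x = e := by rw [sub_smul, hc]; simp
      have hc1 : c - 1 ≠ 0 := by rintro h; rw [h, zero_smul] at hc'; exact he hc'.symm
      exact hx (mem_span_singleton.2 ⟨(c - 1)⁻¹, by
        rw [← hc', smul_smul, inv_mul_cancel₀ hc1, one_smul]⟩)
    refine ⟨(a⁻¹ * b) • f x, ⟨smul_mem _ _ (mem_span_singleton_self _),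
      mem_span_singleton.2 ⟨a⁻¹, ?_⟩⟩, ?_⟩
    · rw [← hab, smul_add, smul_smul, smul_smul, inv_mul_cancel₀ ha, one_smul]
    · rintro w ⟨hw, hw'⟩
      obtain ⟨c, rfl⟩ := mem_span_singleton.1 hw
      obtain ⟨d, hd⟩ := mem_span_singleton.1 hw'
      have hind : ∀ s t : L, s • f e + t • f x = 0 → s = 0 ∧ t = 0 := by
        intro s t hst
        have ht : t = 0 := by
          by_contra ht
          apply hx
          rw [← hf.mem_span_singleton_iff, mem_span_singleton]
          refine ⟨-(t⁻¹ * s), ?_⟩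
          rw [neg_smul, mul_smul, eq_neg_of_add_eq_zero_left hst]
          rw [smul_neg, neg_neg, smul_smul, inv_mul_cancel₀ ht, one_smul]
        subst ht
        have he' : f e ≠ 0 := mt (hf.eq_zero_iff e).1 he
        simpa [he'] using hst
      have h2 : (d * a - 1) • f e + (d * b - c) • f x = 0 := by
        rw [← hab] at hd
        linear_combination (norm := module) hd
      obtain ⟨h3, h4⟩ := hind _ _ h2
      have hd' : d = a⁻¹ := eq_inv_of_mul_eq_one_left (sub_eq_zero.1 h3)
      rw [← sub_eq_zero.1 h4, hd']

/-- Additivity of the normalisation, for vectors independent of each other and of `e`. -/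
theorem normalised_add (hf : PreservesCollinearity K L f) {e x y : V} {w₁ w₂ : W}
    (he : e ≠ 0) (hx : x ∉ span K {e})
    (hy : y ∉ span K {e, x}) (h₁ : w₁ ∈ span L {f x}) (h₁' : f e + w₁ ∈ span L {f (e + x)})
    (h₂ : w₂ ∈ span L {f y}) (h₂' : f e + w₂ ∈ span L {f (e + y)})
    (h₁0 : w₁ ≠ 0) (h₂0 : w₂ ≠ 0) :
    w₁ + w₂ ∈ span L {f (x + y)} ∧ f e + (w₁ + w₂) ∈ span L {f (e + (x + y))} := by
  have hind := fun a b c => hf.linearIndependent_triple (a := a) (b := b) (c := c)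
    he hx hy h₁ h₂ h₁0 h₂0
  have hne₁ : f e + w₁ ≠ 0 := fun h => one_ne_zero (hind 1 1 0 (by simpa using h)).1
  have hne₂ : f e + w₂ ≠ 0 := fun h => one_ne_zero (hind 1 0 1 (by simpa using h)).1
  obtain ⟨s₁, -, hs₁⟩ := exists_smul_eq_of_mem_span_singleton h₁ h₁0
  obtain ⟨s₂, -, hs₂⟩ := exists_smul_eq_of_mem_span_singleton h₂ h₂0
  obtain ⟨t₁, -, ht₁⟩ := exists_smul_eq_of_mem_span_singleton h₁' hne₁
  obtain ⟨t₂, -, ht₂⟩ := exists_smul_eq_of_mem_span_singleton h₂' hne₂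
  have hxy0 : e + (x + y) ≠ 0 := by
    intro h
    apply hy
    rw [mem_span_pair]
    exact ⟨-1, -1, by rw [← sub_eq_zero, ← neg_eq_zero, ← h]; simp; abel⟩
  have hA : f (e + (x + y)) ∈ span L {f x, f (e + y)} :=
    (hf.mem_span_pair_iff _ _ _).2 (mem_span_pair.2 ⟨1, 1, by simp; abel⟩)
  have hB : f (e + (x + y)) ∈ span L {f y, f (e + x)} :=
    (hf.mem_span_pair_iff _ _ _).2 (mem_span_pair.2 ⟨1, 1, by simp; abel⟩)
  have hC : f (e + (x + y)) ∈ span L {f e, f (x + y)} :=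
    (hf.mem_span_pair_iff _ _ _).2 (mem_span_pair.2 ⟨1, 1, by simp⟩)
  have hD : f (x + y) ∈ span L {f x, f y} :=
    (hf.mem_span_pair_iff _ _ _).2 (mem_span_pair.2 ⟨1, 1, by simp⟩)
  obtain ⟨a, b, hab⟩ := mem_span_pair.1 hA
  obtain ⟨c, d, hcd⟩ := mem_span_pair.1 hB
  obtain ⟨p, q, hpq⟩ := mem_span_pair.1 hC
  obtain ⟨k, l, hkl⟩ := mem_span_pair.1 hD
  rw [hs₁, ht₂] at hab
  rw [hs₂, ht₁] at hcd
  rw [hs₁, hs₂] at hkl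
  obtain ⟨e1, e2, e3⟩ := hind (b * t₂ - d * t₁) (a * s₁ - d * t₁) (b * t₂ - c * s₂) (by
    linear_combination (norm := module) hab - hcd)
  obtain ⟨e4, e5, e6⟩ := hind (b * t₂ - p) (a * s₁ - q * (k * s₁)) (b * t₂ - q * (l * s₂)) (by
    rw [← hkl] at hpq
    linear_combination (norm := module) hab - hpq)
  set r := b * t₂ with hr
  have ha : a * s₁ = r := by linear_combination e2 - e1
  have hfe : f (e + (x + y)) = r • (f e + (w₁ + w₂)) := by
    rw [← hab, smul_smul, smul_smul, ha]; module
  have hr0 : r ≠ 0 := by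
    intro h
    rw [h, zero_smul, hf.eq_zero_iff] at hfe
    exact hxy0 hfe
  refine ⟨mem_span_singleton.2 ⟨r⁻¹ * q, ?_⟩, mem_span_singleton.2 ⟨r⁻¹, ?_⟩⟩
  · rw [← hkl, ← sub_eq_zero]
    have h1 : q * (k * s₁) = r := by linear_combination ha - e5
    have h2 : q * (l * s₂) = r := by linear_combination - e6
    simp only [smul_add, smul_smul]
    rw [show r⁻¹ * q * (k * s₁) = 1 by rw [mul_assoc, h1, inv_mul_cancel₀ hr0],
      show r⁻¹ * q * (l * s₂) = 1 by rw [mul_assoc, h2, inv_mul_cancel₀ hr0]]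
    simp
  · rw [hfe, smul_smul, inv_mul_cancel₀ hr0, one_smul]

/-- **Fundamental theorem of projective geometry**, for injective maps preserving and reflecting
collinearity in projective dimension at least two. -/
theorem exists_semilinear (hf : PreservesCollinearity K L f)
    (hdim : ∀ x y : V, ∃ z, z ∉ span K {x, y}) :
    ∃ (σ : K →+* L) (A : V →ₛₗ[σ] W), ∀ x, x ≠ 0 → ∃ c : L, c ≠ 0 ∧ A x = c • f x := by
  obtain ⟨e, he'⟩ := hdim 0 0
  have he : e ≠ 0 := by rintro rfl; exact he' (zero_mem _)
  obtain ⟨φ, hφ⟩ : ∃ φ : V →ₗ[K] K, φ e = 1 := by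
    have h1 : ¬ ∀ φ : Module.Dual K V, φ e = 0 := fun h =>
      he ((Module.forall_dual_apply_eq_zero_iff K e).1 h)
    push Not at h1
    obtain ⟨φ, hφ⟩ := h1
    exact ⟨(φ e)⁻¹ • φ, by simp [hφ]⟩
  -- The kernel of `φ` is a complement of the line of `e`; `B` is the normalised map on it.
  have hC {x : V} (hx : φ x = 0) : x = 0 ∨ x ∉ span K {e} := by
    refine or_iff_not_imp_right.2 fun h => ?_
    obtain ⟨c, rfl⟩ := mem_span_singleton.1 (not_not.1 h)
    have : c = 0 := by simpa [hφ] using hx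
    simp [this]
  have hC' {x y : V} (hx : φ x = 0) (hy : φ y = 0) (hxy : y ∉ span K {x}) :
      y ∉ span K {e, x} := by
    intro h
    obtain ⟨a, b, rfl⟩ := mem_span_pair.1 h
    have : a = 0 := by simpa [hφ, hx] using hy
    exact hxy (mem_span_singleton.2 ⟨b, by simp [this]⟩)
  have hz (x : V) : ∃ z, φ z = 0 ∧ z ∉ span K {x} := by
    obtain ⟨z, hz⟩ := hdim e x
    refine ⟨z - φ z • e, by simp [hφ], fun h => hz ?_⟩
    obtain ⟨c, hc⟩ := mem_span_singleton.1 h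
    exact mem_span_pair.2 ⟨φ z, c, by rw [hc]; abel⟩
  choose B hB using fun x : V => show ∃ w : W, φ x = 0 →
      (w ∈ span L {f x} ∧ f e + w ∈ span L {f (e + x)}) from by
    by_cases hx : φ x = 0
    · obtain ⟨w, hw, -⟩ := hf.existsUnique_normalised he (hC hx)
      exact ⟨w, fun _ => hw⟩
    · exact ⟨0, fun h => absurd h hx⟩
  have hBu {x : V} {w : W} (hx : φ x = 0) (hw : w ∈ span L {f x})
      (hw' : f e + w ∈ span L {f (e + x)}) : B x = w :=
    (hf.existsUnique_normalised he (hC hx)).unique (hB x hx) ⟨hw, hw'⟩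
  have hB_zero : B 0 = 0 := hBu (map_zero φ) (zero_mem _) (by simp [mem_span_singleton_self])
  have hB_ne {x : V} (hx : φ x = 0) (hx0 : x ≠ 0) : B x ≠ 0 := by
    intro h
    have h1 := (hB x hx).2
    rw [h, add_zero, hf.mem_span_singleton_iff, mem_span_singleton] at h1
    obtain ⟨c, hc⟩ := h1
    have h2 : c = 1 := by simpa [hφ, hx] using congrArg φ hc
    apply hx0
    simpa [h2] using hc
  have hB_add_of_indep {x y : V} (hx : φ x = 0) (hy : φ y = 0) (hx0 : x ≠ 0)
      (hxy : y ∉ span K {x}) : B (x + y) = B x + B y := by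
    have hy0 : y ≠ 0 := by rintro rfl; exact hxy (zero_mem _)
    obtain ⟨h1, h2⟩ := hf.normalised_add he ((hC hx).resolve_left hx0) (hC' hx hy hxy)
      (hB x hx).1 (hB x hx).2 (hB y hy).1 (hB y hy).2 (hB_ne hx hx0) (hB_ne hy hy0)
    exact hBu (by simp [hx, hy]) h1 h2
  have hB_add {x y : V} (hx : φ x = 0) (hy : φ y = 0) : B (x + y) = B x + B y := by
    by_cases hx0 : x = 0
    · simp [hx0, hB_zero]
    by_cases hxy : y ∈ span K {x}
    swap
    · exact hB_add_of_indep hx hy hx0 hxy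
    by_cases hy0 : y = 0
    · simp [hy0, hB_zero]
    -- For dependent `x` and `y`, expand `B (x + y + z)` in two ways with `z` off their line.
    obtain ⟨z, hzφ, hzx⟩ := hz x
    have hsub {t : V} (ht : t ∈ span K {x}) : z ∉ span K {t} := fun h =>
      hzx ((span_singleton_le_iff_mem _ _).2 ht h)
    have hyz : y + z ∉ span K {x} := fun h => hzx (by simpa using sub_mem h hxy)
    have h1 : B (x + (y + z)) = B x + (B y + B z) := by
      rw [hB_add_of_indep hx (by simp [hy, hzφ]) hx0 hyz,
        hB_add_of_indep hy hzφ hy0 (hsub hxy)]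
    by_cases hs : x + y = 0
    · rw [← add_assoc, hs, zero_add, ← add_assoc] at h1
      rw [hs, hB_zero]
      exact (by simpa using h1 : B x + B y = 0).symm
    · rw [← add_assoc, hB_add_of_indep (by simp [hx, hy]) hzφ hs
        (hsub (add_mem (mem_span_singleton_self x) hxy)), ← add_assoc] at h1
      exact add_right_cancel h1
  -- On the kernel, `B` multiplies scalars by a factor `s x c`, which does not depend on `x`.
  choose s hs using fun (x : V) (c : K) =>
      show ∃ d : L, φ x = 0 → x ≠ 0 → B (c • x) = d • B x from by
    by_cases hx : φ x = 0 ∧ x ≠ 0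
    swap
    · exact ⟨0, fun h h' => absurd ⟨h, h'⟩ hx⟩
    obtain ⟨t, ht, ht'⟩ := exists_smul_eq_of_mem_span_singleton (hB x hx.1).1 (hB_ne hx.1 hx.2)
    have h1 : f (c • x) ∈ span L {f x} :=
      (hf.mem_span_singleton_iff _ _).2 (mem_span_singleton.2 ⟨c, rfl⟩)
    have h2 := (span_singleton_le_iff_mem _ _).2 h1 (hB (c • x) (by simp [hx.1])).1
    obtain ⟨d, hd⟩ := mem_span_singleton.1 h2
    exact ⟨d * t, fun _ _ => by rw [← hd, ht', smul_smul]⟩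
  have hs_indep {x y : V} (hx : φ x = 0) (hy : φ y = 0) (hx0 : x ≠ 0)
      (hxy : y ∉ span K {x}) (c : K) : s x c = s y c := by
    have hy0 : y ≠ 0 := by rintro rfl; exact hxy (zero_mem _)
    have hxy0 : x + y ≠ 0 := by
      intro h
      exact hxy (by rw [← neg_eq_of_add_eq_zero_right h]; exact neg_mem (mem_span_singleton_self x))
    have hxyφ : φ (x + y) = 0 := by simp [hx, hy]
    have h1 := hs (x + y) c hxyφ hxy0
    rw [smul_add, hB_add (by simp [hx]) (by simp [hy]), hB_add hx hy, hs x c hx hx0,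
      hs y c hy hy0] at h1
    obtain ⟨-, h2, h3⟩ := hf.linearIndependent_triple (a := 0) (b := s x c - s (x + y) c)
      (c := s y c - s (x + y) c) he ((hC hx).resolve_left hx0) (hC' hx hy hxy)
      (hB x hx).1 (hB y hy).1 (hB_ne hx hx0) (hB_ne hy hy0)
      (by linear_combination (norm := module) h1)
    rw [sub_eq_zero.1 h2, sub_eq_zero.1 h3]
  have hs_eq {x y : V} (hx : φ x = 0) (hy : φ y = 0) (hx0 : x ≠ 0) (hy0 : y ≠ 0) (c : K) :
      s x c = s y c := by
    by_cases hxy : y ∈ span K {x}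
    · obtain ⟨z, hzφ, hzx⟩ := hz x
      rw [hs_indep hx hzφ hx0 hzx, hs_indep hy hzφ hy0 fun h =>
        hzx ((span_singleton_le_iff_mem _ _).2 hxy h)]
    · exact hs_indep hx hy hx0 hxy c
  obtain ⟨x₀, hx₀, hx₀'⟩ := hz 0
  have hx₀0 : x₀ ≠ 0 := by rintro rfl; exact hx₀' (zero_mem _)
  have hB_smul {x : V} (hx : φ x = 0) (c : K) : B (c • x) = s x₀ c • B x := by
    by_cases hx0 : x = 0
    · simp [hx0, hB_zero]
    · rw [hs x c hx hx0, hs_eq hx hx₀ hx0 hx₀0]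
  have hinj : Function.Injective fun d : L => d • B x₀ := smul_left_injective L (hB_ne hx₀ hx₀0)
  let σ : K →+* L :=
    { toFun := s x₀
      map_one' := hinj (by simp [← hB_smul hx₀])
      map_zero' := hinj (by simp [← hB_smul hx₀, hB_zero])
      map_mul' := fun c d => hinj (by
        simp only [mul_smul, ← hB_smul hx₀, ← hB_smul (x := d • x₀) (by simp [hx₀])])
      map_add' := fun c d => hinj (by
        simp only [add_smul, ← hB_smul hx₀]
        exact hB_add (by simp [hx₀]) (by simp [hx₀])) }
  have hσ {x : V} (hx : φ x = 0) (c : K) : B (c • x) = σ c • B x := hB_smul hx c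
  let A : V →ₛₗ[σ] W :=
    { toFun := fun v => σ (φ v) • f e + B (v - φ v • e)
      map_add' := fun v w => by
        have : v + w - φ (v + w) • e = (v - φ v • e) + (w - φ w • e) := by
          rw [map_add]; module
        rw [this, hB_add (by simp [hφ]) (by simp [hφ]), map_add, map_add]
        module
      map_smul' := fun c v => by
        have : c • v - φ (c • v) • e = c • (v - φ v • e) := by
          rw [map_smul, smul_eq_mul]; module
        rw [this, hσ (by simp [hφ]), map_smul, smul_eq_mul, map_mul]
        module }
  refine ⟨σ, A, fun x hx => ?_⟩
  have hmem : A x ∈ span L {f x} ∧ A x ≠ 0 := by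
    by_cases hc : φ x = 0
    · have hAx : A x = B x := by simp [A, hc]
      rw [hAx]
      exact ⟨(hB x hc).1, hB_ne hc hx⟩
    · set k := (φ x)⁻¹ • (x - φ x • e) with hk
      have hkφ : φ k = 0 := by simp [hk, hφ]
      have hxk : x = φ x • (e + k) := by
        rw [hk, smul_add, smul_smul, mul_inv_cancel₀ hc]; simp
      have hAx : A x = σ (φ x) • (f e + B k) := by
        have hBk : B (x - φ x • e) = σ (φ x) • B k := by
          rw [← hσ hkφ, hk, smul_smul, mul_inv_cancel₀ hc, one_smul]
        change σ (φ x) • f e + B (x - φ x • e) = _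
        rw [hBk, smul_add]
      refine ⟨?_, ?_⟩
      · rw [hAx]
        refine smul_mem _ _ ((span_singleton_le_iff_mem _ _).2 ?_ (hB k hkφ).2)
        rw [hf.mem_span_singleton_iff, mem_span_singleton]
        exact ⟨(φ x)⁻¹, by
          nth_rw 2 [hxk]; rw [smul_smul, inv_mul_cancel₀ hc, one_smul]⟩
      · rw [hAx]
        refine smul_ne_zero ((map_ne_zero σ).2 hc) fun h => ?_
        have h1 : f e ∈ span L {f k} := by
          rw [eq_neg_of_add_eq_zero_left h]
          exact neg_mem (hB k hkφ).1
        rw [hf.mem_span_singleton_iff, mem_span_singleton] at h1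
        obtain ⟨d, hd⟩ := h1
        have := congrArg φ hd
        simp [hφ, hkφ] at this
  obtain ⟨c, hc⟩ := mem_span_singleton.1 hmem.1
  exact ⟨c, by rintro rfl; exact hmem.2 (by simpa using hc.symm), hc.symm⟩

end PreservesCollinearity

end Projective

section Hyperplanes

variable {H : Type*} [NormedAddCommGroup H] [InnerProductSpace ℂ H] [CompleteSpace H]

/-! ### Hyperplanes of elements of the Grassmannian -/

/-- The vectors of `Z` orthogonal to `v`: a closed hyperplane of `Z` if `v` is a nonzero element of
`Z`, and `Z` itself if `v = 0`. -/
noncomputable def hyp (Z : GrassmannianAlephZero H) (v : H) : GrassmannianAlephZero H :=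
  ⟨Z.1 ⊓ (Submodule.span ℂ {v})ᗮ, IsGr.inf_orthogonal Z.2⟩

theorem mem_hyp {Z : GrassmannianAlephZero H} {v x : H} :
    x ∈ (hyp Z v).1 ↔ x ∈ Z.1 ∧ ⟪v, x⟫_ℂ = 0 := by
  rw [hyp, Submodule.mem_inf, Submodule.mem_orthogonal_singleton_iff_inner_right]

theorem hyp_le (Z : GrassmannianAlephZero H) (v : H) : hyp Z v ≤ Z :=
  fun _ hx => (mem_hyp.1 hx).1

theorem hyp_zero (Z : GrassmannianAlephZero H) : hyp Z 0 = Z :=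
  le_antisymm (hyp_le Z 0) fun _ hx => mem_hyp.2 ⟨hx, inner_zero_left _⟩

theorem notMem_hyp_self {Z : GrassmannianAlephZero H} {v : H} (hv : v ≠ 0) : v ∉ (hyp Z v).1 :=
  fun h => hv (inner_self_eq_zero.1 (mem_hyp.1 h).2)

theorem hyp_covBy {Z : GrassmannianAlephZero H} {v : H} (hv : v ∈ Z.1) (hv0 : v ≠ 0) :
    hyp Z v ⋖ Z := by
  refine ⟨lt_of_le_not_ge (hyp_le Z v) fun h => notMem_hyp_self hv0 (h hv), ?_⟩
  intro Y hY hYZ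
  refine hYZ.not_ge fun z hz => ?_
  obtain ⟨y, hy, hyv⟩ := SetLike.not_le_iff_exists.1 (show ¬ Y.1 ≤ (hyp Z v).1 from hY.not_ge)
  have hyv' : ⟪v, y⟫_ℂ ≠ 0 := fun h => hyv (mem_hyp.2 ⟨hYZ.le hy, h⟩)
  have h1 : z - (⟪v, z⟫_ℂ / ⟪v, y⟫_ℂ) • y ∈ Y.1 := by
    refine hY.le (mem_hyp.2 ⟨Z.1.sub_mem hz (Z.1.smul_mem _ (hYZ.le hy)), ?_⟩)
    rw [inner_sub_right, inner_smul_right, div_mul_cancel₀ _ hyv', sub_self]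
  simpa using Y.1.add_mem h1 (Y.1.smul_mem (⟪v, z⟫_ℂ / ⟪v, y⟫_ℂ) hy)

theorem exists_eq_hyp_of_covBy {N Z : GrassmannianAlephZero H} (h : N ⋖ Z) :
    ∃ w ∈ Z.1, w ≠ 0 ∧ N = hyp Z w := by
  obtain ⟨w, hwZ, hwN, hw0⟩ : ∃ w ∈ Z.1, w ∈ N.1ᗮ ∧ w ≠ 0 := by
    by_contra! hcon
    refine h.lt.not_ge fun q hq => mem_of_orthogonal_relative_complement N.2.1 h.le hq ?_
    intro v hv hvN
    rw [hcon v hv hvN, inner_zero_left]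
  refine ⟨w, hwZ, hw0, ?_⟩
  refine (h.eq_or_eq (c := hyp Z w) (fun x hx => mem_hyp.2 ⟨h.le hx, ?_⟩)
    (hyp_le Z w)).resolve_right (fun hZ => notMem_hyp_self hw0 (hZ ▸ hwZ)) |>.symm
  exact Submodule.inner_left_of_mem_orthogonal hx hwN

/-- Order automorphisms of the Grassmannian carry hyperplanes of `Z` to hyperplanes. -/
theorem exists_map_hyp (k : GrassmannianAlephZero H ≃o GrassmannianAlephZero H)
    {Z : GrassmannianAlephZero H} {v : H} (hv : v ∈ Z.1) :
    ∃ w ∈ (k Z).1, (w = 0 ↔ v = 0) ∧ k (hyp Z v) = hyp (k Z) w := by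
  by_cases hv0 : v = 0
  · exact ⟨0, zero_mem _, by simp [hv0], by rw [hv0, hyp_zero, hyp_zero]⟩
  · obtain ⟨w, hw, hw0, h⟩ := exists_eq_hyp_of_covBy
      (apply_covBy_apply_iff k |>.2 (hyp_covBy hv hv0))
    exact ⟨w, hw, by simp [hw0, hv0], h⟩

theorem exists_symm_map_hyp (k : GrassmannianAlephZero H ≃o GrassmannianAlephZero H)
    {Z : GrassmannianAlephZero H} {v : H} (hv : v ∈ (k Z).1) :
    ∃ w ∈ Z.1, (w = 0 ↔ v = 0) ∧ k (hyp Z w) = hyp (k Z) v := by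
  obtain ⟨w, hw, hw0, h⟩ := exists_map_hyp k.symm hv
  rw [k.symm_apply_apply] at hw h
  exact ⟨w, hw, hw0, by rw [← h, k.apply_symm_apply]⟩

/-- Intersections of two hyperplanes are preserved. -/
theorem mem_map_hyp_hyp (k : GrassmannianAlephZero H ≃o GrassmannianAlephZero H)
    {Z : GrassmannianAlephZero H} {v w p : H} (hv : v ∈ Z.1) (hw : w ∈ Z.1)
    (hpv : p ∈ (k (hyp Z v)).1) (hpw : p ∈ (k (hyp Z w)).1) :
    p ∈ (k (hyp (hyp Z v) w)).1 := by
  obtain ⟨a, -, -, ha⟩ := exists_map_hyp k hv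
  obtain ⟨b, -, -, hb⟩ := exists_map_hyp k hw
  have hle : k.symm (hyp (hyp (k Z) a) b) ≤ hyp (hyp Z v) w := by
    have h1 : k.symm (hyp (hyp (k Z) a) b) ≤ hyp Z v := by
      rw [k.symm_apply_le, ha]; exact hyp_le _ _
    have h2 : k.symm (hyp (hyp (k Z) a) b) ≤ hyp Z w := by
      rw [k.symm_apply_le, hb]
      exact fun x hx => mem_hyp.2 ⟨(mem_hyp.1 (mem_hyp.1 hx).1).1, (mem_hyp.1 hx).2⟩
    exact fun x hx => mem_hyp.2 ⟨h1 hx, (mem_hyp.1 (h2 hx)).2⟩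
  rw [k.symm_apply_le] at hle
  rw [ha, mem_hyp] at hpv
  rw [hb, mem_hyp] at hpw
  exact hle (mem_hyp.2 ⟨mem_hyp.2 hpv, hpw.2⟩)

theorem mem_span_of_hyp_le {Z : GrassmannianAlephZero H} {u v : H} (hu : u ∈ Z.1) (hv : v ∈ Z.1)
    (h : hyp Z v ≤ hyp Z u) : u ∈ Submodule.span ℂ {v} := by
  refine mem_of_orthogonal_relative_complement (Submodule.closed_of_finiteDimensional _)
    ((Submodule.span_singleton_le_iff_mem _ _).2 hv) hu fun x hx hxv => ?_
  rw [← inner_conj_symm, (mem_hyp.1 (h (mem_hyp.2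
    ⟨hx, Submodule.mem_orthogonal_singleton_iff_inner_right.1 hxv⟩))).2, map_zero]

theorem mem_span_pair_of_hyp_hyp_le {Z : GrassmannianAlephZero H} {u v w : H} (hu : u ∈ Z.1)
    (hv : v ∈ Z.1) (hw : w ∈ Z.1) (h : hyp (hyp Z v) w ≤ hyp Z u) :
    u ∈ Submodule.span ℂ {v, w} := by
  have hvw : Submodule.span ℂ {v, w} ≤ Z.1 := by
    rw [Submodule.span_le]
    rintro x (rfl | rfl)
    exacts [hv, hw]
  have : FiniteDimensional ℂ (Submodule.span ℂ {v, w}) :=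
    FiniteDimensional.span_of_finite ℂ (by simp)
  refine mem_of_orthogonal_relative_complement (Submodule.closed_of_finiteDimensional _)
    hvw hu fun x hx hxv => ?_
  rw [Submodule.mem_orthogonal] at hxv
  rw [← inner_conj_symm, (mem_hyp.1 (h (mem_hyp.2 ⟨mem_hyp.2 ⟨hx, hxv v
    (Submodule.subset_span (by simp))⟩, hxv w (Submodule.subset_span (by simp))⟩))).2, map_zero]

end Hyperplanes

section Points

variable {H : Type*} [NormedAddCommGroup H] [InnerProductSpace ℂ H] [CompleteSpace H]

/-! ### The point correspondence inside one element of the Grassmannian -/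

/-- The normal vectors `v ∈ Z` of those hyperplanes of `Z` whose image under `k` contains the point
`p` of `k Z`. It turns out to be a closed hyperplane of `Z`, whose normal vector is the point of `Z`
corresponding to `p`. -/
def normalsThrough (k : GrassmannianAlephZero H ≃o GrassmannianAlephZero H)
    (Z : GrassmannianAlephZero H) {p : H} (hp : p ∈ (k Z).1) : Submodule ℂ H where
  carrier := {v | v ∈ Z.1 ∧ p ∈ (k (hyp Z v)).1}
  zero_mem' := ⟨zero_mem _, by rwa [hyp_zero]⟩
  add_mem' := by
    rintro v w ⟨hv, hpv⟩ ⟨hw, hpw⟩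
    refine ⟨Z.1.add_mem hv hw, ?_⟩
    have hle : hyp (hyp Z v) w ≤ hyp Z (v + w) := fun x hx => mem_hyp.2
      ⟨(mem_hyp.1 (mem_hyp.1 hx).1).1, by
        rw [inner_add_left, (mem_hyp.1 (mem_hyp.1 hx).1).2, (mem_hyp.1 hx).2, add_zero]⟩
    exact k.monotone hle (mem_map_hyp_hyp k hv hw hpv hpw)
  smul_mem' := by
    rintro c v ⟨hv, hpv⟩
    have hle : hyp Z v ≤ hyp Z (c • v) := fun x hx => mem_hyp.2
      ⟨(mem_hyp.1 hx).1, by rw [inner_smul_left, (mem_hyp.1 hx).2, mul_zero]⟩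
    exact ⟨Z.1.smul_mem c hv, k.monotone hle hpv⟩

variable {k : GrassmannianAlephZero H ≃o GrassmannianAlephZero H} {Z : GrassmannianAlephZero H}
  {p : H} {hp : p ∈ (k Z).1}

theorem mem_normalsThrough {v : H} :
    v ∈ normalsThrough k Z hp ↔ v ∈ Z.1 ∧ p ∈ (k (hyp Z v)).1 := Iff.rfl

/-- `normalsThrough k Z hp` has codimension at most one in `Z`. -/
theorem exists_sub_smul_mem_normalsThrough {v w : H} (hv : v ∈ Z.1) (hw : w ∈ Z.1)
    (hwQ : w ∉ normalsThrough k Z hp) :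
    ∃ c : ℂ, v - c • w ∈ normalsThrough k Z hp := by
  obtain ⟨a, haZ, -, ha⟩ := exists_map_hyp k hv
  obtain ⟨b, hbZ, -, hb⟩ := exists_map_hyp k hw
  have hbp : ⟪b, p⟫_ℂ ≠ 0 := fun h => hwQ ⟨hw, by rw [hb]; exact mem_hyp.2 ⟨hp, h⟩⟩
  -- `u₀` is the normal of the hyperplane spanned by `p` and the intersection of the images.
  set u₀ := a - (starRingEnd ℂ) (⟪a, p⟫_ℂ / ⟪b, p⟫_ℂ) • b with hu₀
  have hu₀Z : u₀ ∈ (k Z).1 := Submodule.sub_mem _ haZ (Submodule.smul_mem _ _ hbZ)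
  have hu₀p : ⟪u₀, p⟫_ℂ = 0 := by
    rw [hu₀, inner_sub_left, inner_smul_left, Complex.conj_conj, div_mul_cancel₀ _ hbp, sub_self]
  obtain ⟨u, huZ, hu0, hu⟩ := exists_symm_map_hyp k hu₀Z
  have huQ : u ∈ normalsThrough k Z hp := ⟨huZ, by rw [hu]; exact mem_hyp.2 ⟨hp, hu₀p⟩⟩
  have hle : hyp (hyp Z v) w ≤ hyp Z u := by
    rw [← k.le_iff_le, hu]
    intro x hx
    have h1 : x ∈ (k (hyp Z v)).1 := k.monotone (hyp_le _ _) hx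
    have hle2 : hyp (hyp Z v) w ≤ hyp Z w := fun x hx =>
      mem_hyp.2 ⟨(mem_hyp.1 (mem_hyp.1 hx).1).1, (mem_hyp.1 hx).2⟩
    have h2 : x ∈ (k (hyp Z w)).1 := k.monotone hle2 hx
    rw [ha, mem_hyp] at h1
    rw [hb, mem_hyp] at h2
    refine mem_hyp.2 ⟨h1.1, ?_⟩
    rw [hu₀, inner_sub_left, inner_smul_left, h1.2, h2.2, mul_zero, sub_zero]
  -- If `u` is not a multiple of `w`, it is the required combination up to scaling. Otherwise `u = 0`,
  -- as `w` is not in the subspace, and `v` and `w` define the same hyperplane.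
  obtain ⟨α, β, hαβ⟩ := Submodule.mem_span_pair.1 (mem_span_pair_of_hyp_hyp_le huZ hv hw hle)
  by_cases hα : α = 0
  · rw [hα, zero_smul, zero_add] at hαβ
    by_cases hβ : β = 0
    · rw [hβ, zero_smul] at hαβ
      have h0 : u₀ = 0 := hu0.1 hαβ.symm
      have hle' : hyp Z w ≤ hyp Z v := by
        rw [← k.le_iff_le, ha, hb]
        intro x hx
        rw [mem_hyp] at hx ⊢
        refine ⟨hx.1, ?_⟩
        rw [sub_eq_zero.1 h0, inner_smul_left, hx.2, mul_zero]
      obtain ⟨c, hc⟩ := Submodule.mem_span_singleton.1 (mem_span_of_hyp_le hv hw hle')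
      exact ⟨c, by rw [hc, sub_self]; exact zero_mem _⟩
    · refine absurd ?_ hwQ
      rw [← inv_smul_smul₀ hβ w, hαβ]
      exact Submodule.smul_mem _ _ huQ
  · refine ⟨-(α⁻¹ * β), ?_⟩
    have : v - (-(α⁻¹ * β)) • w = α⁻¹ • u := by
      rw [← hαβ, smul_add, smul_smul, smul_smul, inv_mul_cancel₀ hα]; module
    rw [this]
    exact Submodule.smul_mem _ _ huQ

/-- The part of `normalsThrough k Z hp` orthogonal to an element `Y` of the Grassmannian is closed:
it is the orthogonal complement of the element corresponding to the span of `k Y` and `p`. -/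
theorem isClosed_normalsThrough_inf_orthogonal {Y : GrassmannianAlephZero H} (hYZ : Y ≤ Z) :
    IsClosed (((Z.1 ⊓ Y.1ᗮ) ⊓ normalsThrough k Z hp : Submodule ℂ H) : Set H) := by
  let P : GrassmannianAlephZero H := ⟨(k Y).1 ⊔ Submodule.span ℂ {p}, IsGr.sup (k Y).2⟩
  have hYP : k Y ≤ P := by
    change (k Y).1 ≤ (k Y).1 ⊔ Submodule.span ℂ {p}
    exact le_sup_left
  have hpP : p ∈ P.1 := Submodule.mem_sup_right (Submodule.mem_span_singleton_self p)
  have hPZ : P ≤ k Z := by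
    change (k Y).1 ⊔ Submodule.span ℂ {p} ≤ (k Z).1
    exact sup_le (k.monotone hYZ) ((Submodule.span_singleton_le_iff_mem _ _).2 hp)
  have heq : (Z.1 ⊓ Y.1ᗮ) ⊓ normalsThrough k Z hp = Z.1 ⊓ (k.symm P).1ᗮ := by
    ext v
    simp only [Submodule.mem_inf, mem_normalsThrough]
    constructor
    · rintro ⟨⟨hvZ, hvY⟩, -, hpv⟩
      refine ⟨hvZ, ?_⟩
      have h1 : Y ≤ hyp Z v := fun y hy =>
        mem_hyp.2 ⟨hYZ hy, Submodule.inner_left_of_mem_orthogonal hy hvY⟩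
      have h2 : k.symm P ≤ hyp Z v := by
        rw [k.symm_apply_le]
        change (k Y).1 ⊔ Submodule.span ℂ {p} ≤ (k (hyp Z v)).1
        exact sup_le (k.monotone h1) ((Submodule.span_singleton_le_iff_mem _ _).2 hpv)
      rw [Submodule.mem_orthogonal']
      exact fun x hx => (mem_hyp.1 (h2 hx)).2
    · rintro ⟨hvZ, hvP⟩
      have h1 : k.symm P ≤ hyp Z v := fun x hx =>
        mem_hyp.2 ⟨(k.symm_apply_le.2 hPZ) hx, Submodule.inner_left_of_mem_orthogonal hx hvP⟩
      refine ⟨⟨hvZ, Submodule.orthogonal_le (k.le_symm_apply.2 hYP) hvP⟩, hvZ, ?_⟩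
      rw [k.symm_apply_le] at h1
      exact h1 hpP
  rw [heq]
  exact Z.2.1.inter (Submodule.isClosed_orthogonal _)

/-- A subspace `Q` of codimension at most one in `A` with closed trace on `A` is cut out on `A` by
the inner product with a vector. -/
theorem exists_normal_of_isClosed {A Q : Submodule ℂ H}
    (hcl : IsClosed ((A ⊓ Q : Submodule ℂ H) : Set H))
    (hcod : ∀ v ∈ A, ∀ w ∈ A, w ∉ Q → ∃ c : ℂ, v - c • w ∈ Q) :
    ∃ a ∈ A, ∀ x ∈ A, x ∈ Q ↔ ⟪a, x⟫_ℂ = 0 := by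
  by_cases hAQ : ∀ v ∈ A, v ∈ (A ⊓ Q)ᗮ → v = 0
  · refine ⟨0, zero_mem _, fun x hx => ⟨fun _ => inner_zero_left _, fun _ => ?_⟩⟩
    refine (mem_of_orthogonal_relative_complement hcl inf_le_left hx fun v hv hv' => ?_).2
    rw [hAQ v hv hv', inner_zero_left]
  · push Not at hAQ
    obtain ⟨a, haA, ha, ha0⟩ := hAQ
    refine ⟨a, haA, fun x hx => ⟨fun hxQ =>
      Submodule.inner_left_of_mem_orthogonal (Submodule.mem_inf.2 ⟨hx, hxQ⟩) ha, fun hax => ?_⟩⟩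
    by_contra hxQ
    obtain ⟨c, hc⟩ := hcod a haA x hx hxQ
    have h1 : ⟪a, a - c • x⟫_ℂ = 0 := Submodule.inner_left_of_mem_orthogonal
      (Submodule.mem_inf.2 ⟨A.sub_mem haA (A.smul_mem c hx), hc⟩) ha
    rw [inner_sub_right, inner_smul_right, hax, mul_zero, sub_zero] at h1
    exact ha0 (inner_self_eq_zero.1 h1)

/-- Every element of the Grassmannian is the orthogonal sum of two elements. -/
theorem exists_orthogonal_splitting (Z : GrassmannianAlephZero H) :
    ∃ A B : GrassmannianAlephZero H, B ≤ Z ∧ A.1 = Z.1 ⊓ B.1ᗮ := by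
  obtain ⟨x, y, -, hx, hy, -, hxZ, hyZ, -, hxy, -⟩ :=
    exists_three_orthonormal (⊥ : Submodule ℂ H) Z.2.2.2.1 Z.2.2.2.1 Z.2.2.2.1
  have hle : (Submodule.span ℂ (Set.range x)).topologicalClosure ≤ Z.1 :=
    Submodule.topologicalClosure_minimal _
      (Submodule.span_le.2 (Set.range_subset_iff.2 fun n => (hxZ n).1)) Z.2.1
  let B : GrassmannianAlephZero H := ⟨(Submodule.span ℂ (Set.range x)).topologicalClosure,
    IsGr.of_le Z.2 hle (Submodule.isClosed_topologicalClosure _)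
      (not_finiteDimensional_of_orthonormal hx fun n =>
        Submodule.le_topologicalClosure _ (Submodule.subset_span ⟨n, rfl⟩))⟩
  refine ⟨⟨Z.1 ⊓ B.1ᗮ, IsGr.of_le Z.2 inf_le_left
    (Z.2.1.inter (Submodule.isClosed_orthogonal _))
    (not_finiteDimensional_of_orthonormal hy fun n => ⟨(hyZ n).1, ?_⟩)⟩, B, hle, rfl⟩
  change y n ∈ (Submodule.span ℂ (Set.range x)).topologicalClosureᗮ
  rw [Submodule.orthogonal_closure]
  have h1 : Submodule.span ℂ (Set.range x) ≤ (Submodule.span ℂ {y n})ᗮ := by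
    rw [Submodule.span_le]
    rintro _ ⟨m, rfl⟩
    exact Submodule.mem_orthogonal_singleton_iff_inner_left.2 (hxy m n)
  exact (Submodule.mem_orthogonal _ _).2 fun u hu =>
    Submodule.mem_orthogonal_singleton_iff_inner_left.1 (h1 hu)

/-- The subspace `normalsThrough k Z hp` is closed, because its traces on the two summands of an
orthogonal splitting of `Z` are. -/
theorem isClosed_normalsThrough : IsClosed (normalsThrough k Z hp : Set H) := by
  obtain ⟨A, B, hBZ, hA⟩ := exists_orthogonal_splitting Z
  have hAZ : A ≤ Z := by
    change A.1 ≤ Z.1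
    rw [hA]; exact inf_le_left
  have hcod {S : Submodule ℂ H} : ∀ v ∈ Z.1 ⊓ S, ∀ w ∈ Z.1 ⊓ S, 
      w ∉ normalsThrough k Z hp → ∃ c : ℂ, v - c • w ∈ normalsThrough k Z hp :=
    fun v hv w hw => exists_sub_smul_mem_normalsThrough hv.1 hw.1
  obtain ⟨a, ha, haQ⟩ := exists_normal_of_isClosed
    (isClosed_normalsThrough_inf_orthogonal (k := k) (hp := hp) hBZ) hcod
  obtain ⟨b, hb, hbQ⟩ := exists_normal_of_isClosed
    (isClosed_normalsThrough_inf_orthogonal (k := k) (hp := hp) hAZ) hcod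
  have : CompleteSpace B.1 := B.2.1.completeSpace_coe
  let F := Submodule.span ℂ {a, b}
  have : FiniteDimensional ℂ F := FiniteDimensional.span_of_finite ℂ (by simp)
  have hFZ : F ≤ Z.1 := by
    rw [Submodule.span_le]
    rintro x (rfl | rfl)
    exacts [ha.1, hb.1]
  have hle : Z.1 ⊓ Fᗮ ≤ normalsThrough k Z hp := by
    rintro x ⟨hxZ, hxF⟩
    have hax : ⟪a, x⟫_ℂ = 0 :=
      (Submodule.mem_orthogonal _ _).1 hxF a (Submodule.subset_span (by simp))
    have hbx : ⟪b, x⟫_ℂ = 0 :=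
      (Submodule.mem_orthogonal _ _).1 hxF b (Submodule.subset_span (by simp))
    have h1 : B.1.starProjection x ∈ B.1 := Submodule.starProjection_apply_mem _ _
    have h2 : x - B.1.starProjection x ∈ Z.1 ⊓ B.1ᗮ :=
      ⟨Z.1.sub_mem hxZ (hBZ h1), B.1.sub_starProjection_mem_orthogonal x⟩
    have h3 : B.1.starProjection x ∈ A.1ᗮ := by
      rw [hA]
      exact Submodule.orthogonal_le inf_le_right (Submodule.le_orthogonal_orthogonal _ h1)
    have h4 : x - B.1.starProjection x ∈ A.1 := by rw [hA]; exact h2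
    have h5 : x - B.1.starProjection x ∈ normalsThrough k Z hp := by
      rw [haQ _ h2, inner_sub_right, hax, Submodule.inner_left_of_mem_orthogonal h1 ha.2, sub_zero]
    have h6 : B.1.starProjection x ∈ normalsThrough k Z hp := by
      rw [hbQ _ ⟨hBZ h1, h3⟩, ← sub_sub_cancel x (B.1.starProjection x), inner_sub_right, hbx,
        Submodule.inner_left_of_mem_orthogonal h4 hb.2, sub_zero]
    simpa using add_mem h5 h6
  have heq : normalsThrough k Z hp = (Z.1 ⊓ Fᗮ) ⊔ (normalsThrough k Z hp ⊓ F) := by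
    refine le_antisymm (fun x hx => ?_) (sup_le hle inf_le_left)
    have h1 : F.starProjection x ∈ F := Submodule.starProjection_apply_mem _ _
    have h2 : x - F.starProjection x ∈ Z.1 ⊓ Fᗮ :=
      ⟨Z.1.sub_mem hx.1 (hFZ h1), F.sub_starProjection_mem_orthogonal x⟩
    have h3 : F.starProjection x ∈ normalsThrough k Z hp := by
      simpa using sub_mem hx (hle h2)
    simpa using Submodule.add_mem_sup h2 (Submodule.mem_inf.2 ⟨h3, h1⟩)
  have : FiniteDimensional ℂ (normalsThrough k Z hp ⊓ F : Submodule ℂ H) :=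
    Submodule.finiteDimensional_of_le inf_le_right
  rw [heq]
  exact Submodule.isClosed_sup_finiteDimensional _ _ (Z.2.1.inter (Submodule.isClosed_orthogonal _))

/-- For every point `p` of `k Z` there is a point `q` of `Z` that lies in exactly those `X ≤ Z` for
which `p` lies in `k X`. -/
theorem exists_point_of_le (hp : p ∈ (k Z).1) (hp0 : p ≠ 0) :
    ∃ q ∈ Z.1, q ≠ 0 ∧ ∀ X ≤ Z, q ∈ X.1 ↔ p ∈ (k X).1 := by
  obtain ⟨q, hqZ, hq⟩ := exists_normal_of_isClosed (A := Z.1) (Q := normalsThrough k Z hp)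
    (Z.2.1.inter isClosed_normalsThrough)
    (fun v hv w hw => exists_sub_smul_mem_normalsThrough hv hw)
  have key : ∀ X ≤ Z, q ∈ X.1 ↔ p ∈ (k X).1 := by
    intro X hXZ
    constructor
    · intro hqX
      refine mem_of_orthogonal_relative_complement (k X).2.1 (k.monotone hXZ) hp fun a ha haX => ?_
      obtain ⟨v, hvZ, -, hv⟩ := exists_symm_map_hyp k ha
      have h1 : X ≤ hyp Z v := by
        rw [← k.le_iff_le, hv]
        exact fun x hx => mem_hyp.2
          ⟨k.monotone hXZ hx, Submodule.inner_left_of_mem_orthogonal hx haX⟩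
      have h2 : v ∈ normalsThrough k Z hp := by
        rw [hq v hvZ, ← inner_conj_symm, (mem_hyp.1 (h1 hqX)).2, map_zero]
      have h3 := h2.2
      rw [hv] at h3
      exact (mem_hyp.1 h3).2
    · intro hpX
      refine mem_of_orthogonal_relative_complement X.2.1 hXZ hqZ fun v hv hvX => ?_
      have h1 : X ≤ hyp Z v := fun x hx => mem_hyp.2
          ⟨hXZ hx, Submodule.inner_left_of_mem_orthogonal hx hvX⟩
      rw [← inner_conj_symm, (hq v hv).1 ⟨hv, k.monotone h1 hpX⟩, map_zero]
  refine ⟨q, hqZ, ?_, key⟩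
  rintro rfl
  obtain ⟨v, -, -, hv⟩ := exists_symm_map_hyp k hp
  have := (key (hyp Z v) (hyp_le _ _)).1 (zero_mem _)
  rw [hv] at this
  exact notMem_hyp_self hp0 this

end Points

section Induced

variable {H : Type*} [NormedAddCommGroup H] [InnerProductSpace ℂ H] [CompleteSpace H]

/-! ### The point correspondence on the whole space -/

/-- A finite-dimensional subspace `F` extends to an element of the Grassmannian that avoids a given
vector outside `F`. -/
theorem exists_gr_of_notMem (hH : ¬ FiniteDimensional ℂ H) (F : Submodule ℂ H)
    [FiniteDimensional ℂ F] {r : H} (hr : r ∉ F) :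
    ∃ X : GrassmannianAlephZero H, F ≤ X.1 ∧ r ∉ X.1 := by
  have htop : ¬ FiniteDimensional ℂ (⊤ : Submodule ℂ H) := fun _ =>
    hH (Submodule.topEquiv (R := ℂ) (M := H)).finiteDimensional
  obtain ⟨x, y, -, hx, hy, -, hxF, -, -, hxy, -⟩ :=
    exists_three_orthonormal (F ⊔ Submodule.span ℂ {r}) htop htop htop
  set r' := r - F.starProjection r with hr'
  have hrF : F.starProjection r ∈ F := Submodule.starProjection_apply_mem _ _
  have hr'F : r' ∈ Fᗮ := F.sub_starProjection_mem_orthogonal r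
  have hr'0 : r' ≠ 0 := fun h => hr (by rw [sub_eq_zero.1 h]; exact hrF)
  have hr'mem : r' ∈ F ⊔ Submodule.span ℂ {r} := sub_mem
    (Submodule.mem_sup_right (Submodule.mem_span_singleton_self r)) (Submodule.mem_sup_left hrF)
  have hY := isGr_of_orthonormal (Set.countable_range x) hx hy (fun n => ⟨n, rfl⟩) (by
    rintro n _ ⟨m, rfl⟩
    exact hxy m n)
  refine ⟨⟨_, IsGr.sup (F := F) hY⟩, le_sup_right, fun hrX => ?_⟩
  have hle : (Submodule.span ℂ (Set.range x)).topologicalClosure ⊔ F ≤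
      (Submodule.span ℂ {r'})ᗮ := by
    refine sup_le (Submodule.topologicalClosure_minimal _ (Submodule.span_le.2 ?_)
      (Submodule.isClosed_orthogonal _)) fun z hz => ?_
    · rintro _ ⟨n, rfl⟩
      exact Submodule.mem_orthogonal_singleton_iff_inner_right.2
        ((Submodule.mem_orthogonal _ _).1 (hxF n).2 r' hr'mem)
    · exact Submodule.mem_orthogonal_singleton_iff_inner_right.2
        (Submodule.inner_left_of_mem_orthogonal hz hr'F)
  have h1 : r' ∈ (Submodule.span ℂ {r'})ᗮ :=
    hle (sub_mem hrX (Submodule.mem_sup_right hrF))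
  exact hr'0 (inner_self_eq_zero.1 (Submodule.mem_orthogonal_singleton_iff_inner_right.1 h1))

/-- The span of two vectors is the intersection of the elements of the Grassmannian containing
them. -/
theorem mem_span_pair_iff_forall_gr (hH : ¬ FiniteDimensional ℂ H) (x y z : H) :
    x ∈ Submodule.span ℂ {y, z} ↔
      ∀ X : GrassmannianAlephZero H, y ∈ X.1 → z ∈ X.1 → x ∈ X.1 := by
  constructor
  · intro hx X hy hz
    obtain ⟨a, b, rfl⟩ := Submodule.mem_span_pair.1 hx
    exact X.1.add_mem (X.1.smul_mem a hy) (X.1.smul_mem b hz)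
  · intro h
    by_contra hx
    have : FiniteDimensional ℂ (Submodule.span ℂ {y, z}) :=
      FiniteDimensional.span_of_finite ℂ (by simp)
    obtain ⟨X, hX, hxX⟩ := exists_gr_of_notMem hH _ hx
    exact hxX (h X (hX (Submodule.subset_span (by simp))) (hX (Submodule.subset_span (by simp))))

/-- Two elements of the Grassmannian through a common point are linked by a third one that meets
both in elements of the Grassmannian through the point. -/
theorem exists_link (hH : ¬ FiniteDimensional ℂ H) {X Y : GrassmannianAlephZero H} {p : H}
    (hX : p ∈ X.1) (hY : p ∈ Y.1) :
    ∃ T U V : GrassmannianAlephZero H, U ≤ X ∧ U ≤ T ∧ V ≤ Y ∧ V ≤ T ∧ p ∈ U.1 ∧ p ∈ V.1 := by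
  have htop : ¬ FiniteDimensional ℂ (⊤ : Submodule ℂ H) := fun _ =>
    hH (Submodule.topEquiv (R := ℂ) (M := H)).finiteDimensional
  obtain ⟨x, y, z, hx, hy, hz, hxX, hyY, hzp, hxy, hxz, hyz⟩ :=
    exists_three_orthonormal (Submodule.span ℂ {p}) X.2.2.2.1 Y.2.2.2.1 htop
  let S : Set H := {p} ∪ Set.range x ∪ Set.range y
  have hxS (n) : x n ∈ S := Or.inl (Or.inr ⟨n, rfl⟩)
  have hyS (n) : y n ∈ S := Or.inr ⟨n, rfl⟩
  have hT : IsGr (Submodule.span ℂ S).topologicalClosure := by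
    refine isGr_of_orthonormal (((Set.countable_singleton p).union (Set.countable_range x)).union
      (Set.countable_range y)) hx hz hxS ?_
    rintro n s ((rfl | ⟨m, rfl⟩) | ⟨m, rfl⟩)
    · exact Submodule.mem_orthogonal_singleton_iff_inner_right.1 (hzp n).2
    · exact hxz m n
    · exact hyz m n
  have hST {s : H} (hs : s ∈ S) : s ∈ (Submodule.span ℂ S).topologicalClosure :=
    Submodule.le_topologicalClosure _ (Submodule.subset_span hs)
  have hpS : p ∈ S := Or.inl (Or.inl rfl)
  exact ⟨⟨_, hT⟩,
    ⟨_, IsGr.of_le X.2 inf_le_left (X.2.1.inter hT.1)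
      (not_finiteDimensional_of_orthonormal hx fun n => ⟨(hxX n).1, hST (hxS n)⟩)⟩,
    ⟨_, IsGr.of_le Y.2 inf_le_left (Y.2.1.inter hT.1)
      (not_finiteDimensional_of_orthonormal hy fun n => ⟨(hyY n).1, hST (hyS n)⟩)⟩,
    fun _ h => h.1, fun _ h => h.2, fun _ h => h.1, fun _ h => h.2, ⟨hX, hST hpS⟩, ⟨hY, hST hpS⟩⟩

/-- A point is determined by the elements of the Grassmannian below `Z` through it. -/
theorem mem_span_singleton_of_forall_le {Z : GrassmannianAlephZero H} {q r : H} (hq : q ∈ Z.1)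
    (h : ∀ X ≤ Z, q ∈ X.1 → r ∈ X.1) : r ∈ Submodule.span ℂ {q} := by
  refine mem_of_orthogonal_relative_complement (Submodule.closed_of_finiteDimensional _)
    ((Submodule.span_singleton_le_iff_mem _ _).2 hq) (h Z le_rfl hq) fun v hv hvq => ?_
  exact (mem_hyp.1 (h (hyp Z v) (hyp_le Z v) (mem_hyp.2
    ⟨hq, Submodule.mem_orthogonal_singleton_iff_inner_left.1 hvq⟩))).2

/-- The points assigned to `p` inside `Z₁` and inside `Z₂` span the same line as soon as `k Z₁` and
`k Z₂` have a common lower bound through `p`. -/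
theorem mem_span_singleton_of_common_le
    {k : GrassmannianAlephZero H ≃o GrassmannianAlephZero H} {Z₁ Z₂ W : GrassmannianAlephZero H}
    {p q₁ q₂ : H} (h₁ : ∀ X ≤ Z₁, q₁ ∈ X.1 ↔ p ∈ (k X).1) (h₂ : ∀ X ≤ Z₂, q₂ ∈ X.1 ↔ p ∈ (k X).1)
    (hW₁ : W ≤ k Z₁) (hW₂ : W ≤ k Z₂) (hp : p ∈ W.1) : q₁ ∈ Submodule.span ℂ {q₂} := by
  rw [← k.symm_apply_le] at hW₁ hW₂
  refine mem_span_singleton_of_forall_le (Z := k.symm W)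
    ((h₂ _ hW₂).2 (by rwa [k.apply_symm_apply])) fun X hX hq => ?_
  exact (h₁ X (hX.trans hW₁)).2 ((h₂ X (hX.trans hW₂)).1 hq)

/-- The point assigned to `p` inside one `Z` serves all `X` with `p ∈ k X`: the assignments made
inside `Z` and inside `X` are compared along the chain of `exists_link`. -/
theorem exists_point_forward (hH : ¬ FiniteDimensional ℂ H)
    (k : GrassmannianAlephZero H ≃o GrassmannianAlephZero H) {p : H} (hp : p ≠ 0) :
    ∃ q : H, q ≠ 0 ∧ ∀ X, p ∈ (k X).1 → q ∈ X.1 := by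
  obtain ⟨r, hr⟩ : ∃ r, r ∉ Submodule.span ℂ {p} := by
    by_contra! h
    refine hH (Module.finite_def.2 ?_)
    rw [← Submodule.eq_top_iff'.2 h]
    exact Submodule.fg_span (by simp)
  obtain ⟨Y, hY, -⟩ := exists_gr_of_notMem hH _ hr
  obtain ⟨Z, rfl⟩ := k.surjective Y
  have hpZ : p ∈ (k Z).1 := hY (Submodule.mem_span_singleton_self p)
  obtain ⟨q, hqZ, hq0, hq⟩ := exists_point_of_le hpZ hp
  refine ⟨q, hq0, fun X hX => ?_⟩
  obtain ⟨T, U, V, hUZ, hUT, hVX, hVT, hpU, hpV⟩ := exists_link hH hpZ hX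
  obtain ⟨T, rfl⟩ := k.surjective T
  obtain ⟨t, -, -, ht⟩ := exists_point_of_le (hUT hpU) hp
  obtain ⟨s, hsX, -, hs⟩ := exists_point_of_le hX hp
  have h1 := mem_span_singleton_of_common_le hq ht hUZ hUT hpU
  have h2 := mem_span_singleton_of_common_le ht hs hVT hVX hpV
  exact (Submodule.span_singleton_le_iff_mem _ _).2 hsX
    ((Submodule.span_singleton_le_iff_mem _ _).2 h2 h1)

/-- Every point `p` of `H` corresponds to a point `q` lying in exactly those `X` for which `p` lies
in `k X`. -/
theorem exists_point (hH : ¬ FiniteDimensional ℂ H)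
    (k : GrassmannianAlephZero H ≃o GrassmannianAlephZero H) {p : H} (hp : p ≠ 0) :
    ∃ q : H, q ≠ 0 ∧ ∀ X, q ∈ X.1 ↔ p ∈ (k X).1 := by
  obtain ⟨q, hq0, hq⟩ := exists_point_forward hH k hp
  obtain ⟨p', hp'0, hp'⟩ := exists_point_forward hH k.symm hq0
  have hp'' : ∀ Y, q ∈ Y.1 → p' ∈ (k Y).1 := fun Y hY => hp' _ (by rwa [k.symm_apply_apply])
  have h1 : p' ∈ Submodule.span ℂ {p} := by
    have := (mem_span_pair_iff_forall_gr hH p' p p).2 fun X hX _ => by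
      obtain ⟨Y, rfl⟩ := k.surjective X
      exact hp'' Y (hq Y hX)
    simpa using this
  -- Going forward and back leads to a multiple of `p`, which gives the converse implication.
  refine ⟨q, hq0, fun X => ⟨fun hX => ?_, hq X⟩⟩
  obtain ⟨c, -, hc⟩ := exists_smul_eq_of_mem_span_singleton h1 hp'0
  rw [hc]
  exact (k X).1.smul_mem c (hp'' X hX)

/-- An order automorphism of the Grassmannian is induced, as far as incidence with points is
concerned, by a semilinear map with respect to some endomorphism of the field. -/
theorem exists_semilinear_mem_iff (hH : ¬ FiniteDimensional ℂ H)
    (h : GrassmannianAlephZero H ≃o GrassmannianAlephZero H) :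
    ∃ (σ : ℂ →+* ℂ) (A : H →ₛₗ[σ] H), ∀ x X, A x ∈ (h X).1 ↔ x ∈ X.1 := by
  choose f hf using fun x : H =>
      show ∃ q : H, (q = 0 ↔ x = 0) ∧ ∀ X, q ∈ (h X).1 ↔ x ∈ X.1 from by
    by_cases hx : x = 0
    · exact ⟨0, by simp [hx], fun X => by simp [hx, zero_mem]⟩
    · obtain ⟨q, hq0, hq⟩ := exists_point hH h.symm hx
      exact ⟨q, by simp [hq0, hx], fun X => by rw [hq, h.symm_apply_apply]⟩
  have hcol : PreservesCollinearity ℂ ℂ f := by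
    refine ⟨fun x => (hf x).1, fun x y z => ?_⟩
    rw [mem_span_pair_iff_forall_gr hH, mem_span_pair_iff_forall_gr hH, h.surjective.forall]
    simp only [(hf _).2]
  obtain ⟨σ, A, hA⟩ := hcol.exists_semilinear fun x y => by
    by_contra! hxy
    refine hH (Module.finite_def.2 ?_)
    rw [← Submodule.eq_top_iff'.2 hxy]
    exact Submodule.fg_span (by simp)
  refine ⟨σ, A, fun x X => ?_⟩
  by_cases hx : x = 0
  · simp [hx, zero_mem]
  · obtain ⟨c, hc, hAx⟩ := hA x hx
    rw [hAx, Submodule.smul_mem_iff _ hc, (hf x).2]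

/-! ### Continuity -/

section Continuity

variable {h : GrassmannianAlephZero H ≃o GrassmannianAlephZero H} {σ : ℂ →+* ℂ} {A : H →ₛₗ[σ] H}

/-- Corresponding hyperplanes have normal functionals that correspond under `A` and `σ`, up to a
scalar. -/
theorem exists_inner_map_eq (hA : ∀ x X, A x ∈ (h X).1 ↔ x ∈ X.1) {X : GrassmannianAlephZero H}
    {n y : H} (hn : n ∈ X.1) (hn0 : n ≠ 0) (hny : h (hyp X n) = hyp (h X) y) :
    ∃ c : ℂ, c ≠ 0 ∧ ∀ x ∈ X.1, ⟪y, A x⟫_ℂ = σ ⟪n, x⟫_ℂ * c := by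
  have hnn : ⟪n, n⟫_ℂ ≠ 0 := fun h => hn0 (inner_self_eq_zero.1 h)
  set x₀ := (⟪n, n⟫_ℂ)⁻¹ • n with hx₀
  have hx₀X : x₀ ∈ X.1 := X.1.smul_mem _ hn
  have hnx₀ : ⟪n, x₀⟫_ℂ = 1 := by rw [hx₀, inner_smul_right, inv_mul_cancel₀ hnn]
  have hker {x : H} (hx : x ∈ X.1) : ⟪y, A x⟫_ℂ = 0 ↔ ⟪n, x⟫_ℂ = 0 := by
    have := hA x (hyp X n)
    rw [hny, mem_hyp, mem_hyp, hA] at this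
    simpa [hx] using this
  refine ⟨⟪y, A x₀⟫_ℂ, fun h0 => ?_, fun x hx => ?_⟩
  · rw [hker hx₀X, hnx₀] at h0
    exact one_ne_zero h0
  · have h1 : ⟪n, x - ⟪n, x⟫_ℂ • x₀⟫_ℂ = 0 := by
      rw [inner_sub_right, inner_smul_right, hnx₀, mul_one, sub_self]
    rw [← hker (X.1.sub_mem hx (X.1.smul_mem _ hx₀X)), map_sub, LinearMap.map_smulₛₗ,
      inner_sub_right, inner_smul_right, sub_eq_zero] at h1
    exact h1

/-- A discontinuous `σ` would be unbounded near zero; an element of `X` with rapidly decreasing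
coordinates that `σ` blows up would then have a normal functional whose image is unbounded. -/
theorem continuous_of_mem_iff (hH : ¬ FiniteDimensional ℂ H)
    (hA : ∀ x X, A x ∈ (h X).1 ↔ x ∈ X.1) : Continuous σ := by
  by_contra hσ
  have hunb (C r : ℝ) (hr : 0 < r) : ∃ a : ℂ, ‖a‖ < r ∧ C < ‖σ a‖ := by
    by_contra! hcon
    refine hσ ((σ : ℂ →+ ℂ).continuous_of_isBounded_nhds_zero (Metric.ball_mem_nhds 0 hr) ?_)
    refine isBounded_iff_forall_norm_le.2 ⟨C, ?_⟩
    rintro _ ⟨a, ha, rfl⟩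
    exact hcon a (by simpa using ha)
  obtain ⟨r, hr⟩ : ∃ r : H, r ∉ (⊥ : Submodule ℂ H) := by
    by_contra! hcon
    refine hH (Module.finite_def.2 ?_)
    rw [← Submodule.eq_top_iff'.2 hcon]
    exact Submodule.fg_bot
  obtain ⟨X, -, -⟩ := exists_gr_of_notMem hH _ hr
  obtain ⟨u, -, -, hu, -, -, huX, -⟩ :=
    exists_three_orthonormal (⊥ : Submodule ℂ H) X.2.2.2.1 X.2.2.2.1 X.2.2.2.1
  -- The coordinates are small enough to be summable, while `σ` takes them beyond `n * ‖A (u n)‖`.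
  choose a ha hσa using fun n : ℕ => hunb (n * (‖A (u n)‖ + 1)) ((1 / 2 : ℝ) ^ n) (by positivity)
  have hsum : Summable fun n => (starRingEnd ℂ) (a n) • u n := by
    refine Summable.of_norm_bounded summable_geometric_two fun n => ?_
    rw [norm_smul, hu.1 n, mul_one, RCLike.norm_conj]
    exact (ha n).le
  set v := ∑' n, (starRingEnd ℂ) (a n) • u n with hv
  have hvX : v ∈ X.1 := X.2.1.mem_of_tendsto hsum.hasSum (Filter.Eventually.of_forall fun s =>
    X.1.sum_mem fun n _ => X.1.smul_mem _ (huX n).1)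
  have hinner (n : ℕ) : ⟪v, u n⟫_ℂ = a n := by
    have h1 : HasSum (fun m => ⟪u n, (starRingEnd ℂ) (a m) • u m⟫_ℂ) ⟪u n, v⟫_ℂ :=
      hsum.hasSum.mapL (innerSL ℂ (u n))
    have h2 : HasSum (fun m => ⟪u n, (starRingEnd ℂ) (a m) • u m⟫_ℂ) ((starRingEnd ℂ) (a n)) := by
      convert hasSum_single n fun m hm => ?_ using 1
      · rw [inner_smul_right, inner_self_eq_norm_sq_to_K, hu.1 n]; simp
      · rw [inner_smul_right, hu.2 hm.symm, mul_zero]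
    rw [← inner_conj_symm, h1.unique h2, Complex.conj_conj]
  have hv0 : v ≠ 0 := by
    intro h0
    have h1 := hσa 0
    rw [← hinner 0, h0, inner_zero_left, map_zero] at h1
    simp at h1
  obtain ⟨y, -, -, hy⟩ := exists_map_hyp h hvX
  obtain ⟨c, hc, hyA⟩ := exists_inner_map_eq hA hvX hv0 hy
  obtain ⟨n, hn⟩ := exists_nat_gt (‖y‖ / ‖c‖)
  have hc' : 0 < ‖c‖ := norm_pos_iff.2 hc
  have h1 : ‖σ (a n)‖ * ‖c‖ ≤ ‖y‖ * ‖A (u n)‖ := by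
    rw [← norm_mul, ← hinner n, ← hyA (u n) (huX n).1]
    exact norm_inner_le_norm _ _
  rw [div_lt_iff₀ hc'] at hn
  have h2 : n * (‖A (u n)‖ + 1) * ‖c‖ < ‖σ (a n)‖ * ‖c‖ := mul_lt_mul_of_pos_right (hσa n) hc'
  have h3 : ‖y‖ * ‖A (u n)‖ ≤ n * ‖c‖ * ‖A (u n)‖ :=
    mul_le_mul_of_nonneg_right hn.le (norm_nonneg _)
  have h4 : (0 : ℝ) ≤ n * ‖c‖ := by positivity
  linarith

/-- Restrictions of `A` have closed graph, because `A` intertwines enough continuous functionals. The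
closed graph theorem is used over `ℝ`, which treats linear and conjugate-linear maps alike. -/
theorem boundedOnElements_of_mem_iff (hA : ∀ x X, A x ∈ (h X).1 ↔ x ∈ X.1) (hσ : Continuous σ)
    (hσr : ∀ r : ℝ, σ r = r) : BoundedOnElements A := by
  intro X
  have : CompleteSpace X.1 := X.2.1.completeSpace_coe
  let T : X.1 →ₗ[ℝ] H :=
    { toFun := fun x => A x
      map_add' := fun x y => by simp
      map_smul' := fun r x => by
        change A (((r : ℂ) • x : X.1) : H) = (r : ℂ) • A x
        rw [Submodule.coe_smul, LinearMap.map_smulₛₗ, hσr] }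
  have hT : Continuous T := by
    refine T.continuous_of_seq_closed_graph fun u x y hux huy => ?_
    have hux' : Filter.Tendsto (fun n => (u n : H)) Filter.atTop (nhds (x : H)) :=
      (continuous_subtype_val.tendsto x).comp hux
    have hyX : y ∈ (h X).1 := (h X).2.1.mem_of_tendsto huy
      (Filter.Eventually.of_forall fun n => (hA _ _).2 (u n).2)
    have hw : y - A x ∈ (h X).1 := (h X).1.sub_mem hyX ((hA _ _).2 x.2)
    by_contra hne
    have hw0 : y - A x ≠ 0 := sub_ne_zero.2 hne
    obtain ⟨n, hn, hn0, hny⟩ := exists_symm_map_hyp h hw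
    obtain ⟨c, -, hc⟩ := exists_inner_map_eq hA hn (mt hn0.1 hw0) hny
    have h1 : Filter.Tendsto (fun m => ⟪y - A x, A (u m)⟫_ℂ) Filter.atTop
        (nhds ⟪y - A x, A x⟫_ℂ) := by
      simp only [hc _ (u _).2, hc _ x.2]
      exact ((hσ.tendsto _).comp (tendsto_const_nhds.inner hux')).mul_const c
    have h2 : Filter.Tendsto (fun m => ⟪y - A x, A (u m)⟫_ℂ) Filter.atTop
        (nhds ⟪y - A x, y⟫_ℂ) := tendsto_const_nhds.inner huy
    have h3 := tendsto_nhds_unique h2 h1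
    rw [← sub_eq_zero, ← inner_sub_right] at h3
    exact hw0 (inner_self_eq_zero.1 h3)
  let T' : X.1 →L[ℝ] H := ⟨T, hT⟩
  exact ⟨‖T'‖, fun x hx => T'.le_opNorm ⟨x, hx⟩⟩

theorem bijective_of_mem_iff (hH : ¬ FiniteDimensional ℂ H)
    (hA : ∀ x X, A x ∈ (h X).1 ↔ x ∈ X.1) (hσ : Function.Surjective σ) :
    Function.Bijective A := by
  have hspan {x y : H} (hxy : ∀ X : GrassmannianAlephZero H, y ∈ X.1 → x ∈ X.1) :
      x ∈ Submodule.span ℂ {y} := by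
    simpa using (mem_span_pair_iff_forall_gr hH x y y).2 fun X hX _ => hxy X hX
  have hinj {x : H} (hx : A x = 0) : x = 0 := by
    have := hspan (x := x) (y := 0) fun X _ => (hA x X).1 (by rw [hx]; exact zero_mem _)
    simpa using this
  refine ⟨(injective_iff_map_eq_zero A).2 fun x => hinj, fun q => ?_⟩
  by_cases hq : q = 0
  · exact ⟨0, by rw [hq, map_zero]⟩
  obtain ⟨p, hp0, hp⟩ := exists_point hH h hq
  have hq' : q ∈ Submodule.span ℂ {A p} := hspan fun X hX => by
    obtain ⟨Y, rfl⟩ := h.surjective X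
    exact (hp Y).1 ((hA p Y).1 hX)
  obtain ⟨c, hc⟩ := Submodule.mem_span_singleton.1 hq'
  obtain ⟨d, rfl⟩ := hσ c
  exact ⟨d • p, by rw [LinearMap.map_smulₛₗ, hc]⟩

end Continuity

end Induced

theorem isInducedBy_of_mem_iff {H : Type*} [NormedAddCommGroup H] [InnerProductSpace ℂ H]
    {h : GrassmannianAlephZero H ≃o GrassmannianAlephZero H} {σ : ℂ →+* ℂ} {A : H →ₛₗ[σ] H}
    (hA : ∀ x X, A x ∈ (h X).1 ↔ x ∈ X.1)
    (hbij : Function.Bijective A) : IsInducedBy h A := by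
  intro X
  ext y
  constructor
  · intro hy
    obtain ⟨x, rfl⟩ := hbij.2 y
    exact ⟨x, (hA x X).1 hy, rfl⟩
  · rintro ⟨x, hx, rfl⟩
    exact (hA x X).2 hx

theorem mainTheorem4 {H : Type*} [NormedAddCommGroup H] [InnerProductSpace ℂ H] [CompleteSpace H]
    (hH : ¬ FiniteDimensional ℂ H)
    (h : GrassmannianAlephZero H → GrassmannianAlephZero H)
    (hbij : Function.Bijective h)
    (hord : ∀ X Y : GrassmannianAlephZero H, X.1 ≤ Y.1 ↔ (h X).1 ≤ (h Y).1) :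
    (∃ A : H ≃ₗ[ℂ] H, IsInducedBy h A ∧ BoundedOnElements (A : H → H)) ∨
    (∃ A : H ≃ₛₗ[starRingEnd ℂ] H, IsInducedBy h A ∧ BoundedOnElements (A : H → H)) := by
  let k : GrassmannianAlephZero H ≃o GrassmannianAlephZero H :=
    { Equiv.ofBijective h hbij with map_rel_iff' := fun {X Y} => (hord X Y).symm }
  obtain ⟨σ, A, hA⟩ := exists_semilinear_mem_iff hH k
  have hσ := continuous_of_mem_iff hH hA
  rcases Complex.ringHom_eq_id_or_conj_of_continuous hσ with rfl | rfl
  · have hAbij := bijective_of_mem_iff hH hA Function.surjective_id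
    exact Or.inl ⟨LinearEquiv.ofBijective A hAbij, isInducedBy_of_mem_iff hA hAbij,
      boundedOnElements_of_mem_iff hA hσ fun _ => rfl⟩
  · have hAbij := bijective_of_mem_iff hH hA (starRingAut (R := ℂ)).surjective
    exact Or.inr ⟨LinearEquiv.ofBijective A hAbij, isInducedBy_of_mem_iff hA hAbij,
      boundedOnElements_of_mem_iff hA hσ Complex.conj_ofReal⟩
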